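/- Let $\Gamma,\Sigma$ be finite alphabets and let ${\bf R}=(R,\Gamma,c,\Sigma)$ be a representation system: $R\subseteq\Gamma^*$ and $c$ maps every $r\in R$ to a language $c(r)\subseteq\Sigma^*$; membership in $R$, and membership $x\in c(r)$ for given $x\in\Sigma^*$, $r\in R$, are decidable. Let $R^{\le s}$ be the set of representations of length at most $s$. Let $L$ be a deterministic pac-algorithm for ${\bf R}$ with sample complexity $m(n,s,\epsilon,\delta)>0$. That is, $L$ is a deterministic algorithm which on input $s,n\ge 1$ and (rational) $\epsilon,\delta>0$, with access to an oracle that draws examples independently from a probability distribution $D$ on $\Sigma^{\le n}$ and labels them according to a target $r\in R^{\le s}$, always stops after at most $m(n,s,\epsilon,\delta)$ examples and with probability at least $1-\delta$ outputs some $r'\in R$ with $D(c(r')\,\Delta\,c(r))\le\epsilon$; this holds for all $s,n,\epsilon,\delta$, $r\in R^{\le s}$ and $D$. Here $m(n,s,\epsilon,\delta)$ is defined for all real $\epsilon,\delta>0$ and nonincreasing in $\epsilon$. Assume that for all fixed $n,s,\delta$, $m(n,s,\epsilon,\delta)=o(1/\epsilon^2)$ as $\epsilon\to 0^+$. Let $M$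 be a majority-of-three algorithm for ${\bf R}$ with expansion function $e$, that is, an algorithm which from any $r_1,r_2,r_3\in R^{\le s}$ computes a representation $r'\in R$ of length at most $e(s)$ of the concept $\mathrm{MAJ}(r_1,r_2,r_3)$ of all $x$ that belong to at least two of $c(r_1),c(r_2),c(r_3)$. Then there is an Occam algorithm for ${\bf R}$ with compression $$f(m,n,s,\gamma)=\frac{m}{3\,n\,b\;m\!\left(n,s,\frac{1}{2\sqrt m},\frac{\gamma}{3}\right)},\qquad b=\max(1,\log_2|\Sigma|)$$ (so $b=1$ for $\Sigma=\{0,1\}$). That is, there are a randomized algorithm $A$ and a constant $C$ such that for all $s,n\ge1$, all rational $\gamma>0$, all targets $r\in R^{\le s}$ and every sample of $m\ge1$ examples from $\Sigma^{\le n}$ labelled according to $r$ (repetitions allowed), $A$, on input $s,n,\gamma$ and the sample, outputs with probability at least $1-\gamma$ a representation $r'\in R$ which is consistent with the sample and satisfies $$K(r'\mid r,n,s)<\frac{m}{f(m,n,s,\gamma)}+C ,$$ where $K(\cdot\mid\cdot)$ is conditional prefix Kolmogorov complexity. Moreover, for all $n,s\ge1$ and $\gamma>0$, $f(m,n,s,\gamma)\to\infty$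 as $m\to\infty$, and $f(m,n,s,\gamma)$ is nondecreasing in $m\ge1$ whenever $\epsilon^2\,m(n,s,\epsilon,\gamma/3)$ is nondecreasing in $\epsilon>0$. -/

import Mathlib

open Filter Topology MeasureTheory Set
open scoped ENNReal

noncomputable section

/-- All languages are discrete measurable spaces: every set of strings is an event. -/
instance instMeasurableSpaceStrings (q : ℕ) : MeasurableSpace (List (Fin q)) := ⊤

/-! ### Interactive computations -/

/-- An interactive (partial recursive) procedure `A` gets an input `a : α` and reads symbols of `β`
from a one-way source, one at a time.  `A (a, t)` is its behaviour after it has read the symbols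
`t`: the value `none` is the request for the next symbol and `some y` means that it stops with
output `y`.  `OutputsAfter A a t y` says that `A`, on input `a`, reads exactly the symbols `t` and
then stops with output `y`. -/
def OutputsAfter {α β ρ : Type} (A : α × List β →. Option ρ) (a : α) (t : List β) (y : ρ) : Prop :=
  some y ∈ A (a, t) ∧ ∀ u : List β, u <+: t → u ≠ t → none ∈ A (a, u)

/-- The first `j` symbols of an infinite sequence. -/
def firstSymbols {β : Type} (ω : ℕ → β) (j : ℕ) : List β := (List.range j).map ω

/-! ### Conditional prefix Kolmogorov complexity -/

section Kolmogorov

variable {α β : Type} [Primcodable α] [Primcodable β]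

/-- The self-delimiting machine with code `e` as an interactive procedure: it is given the condition
`y`, reads the bits of its program one at a time and stops with an output in `α`. -/
def selfDelimiting (α β : Type) [Primcodable α] [Primcodable β] (e : Nat.Partrec.Code) :
    β × List Bool →. Option α :=
  fun z => (e.eval (Encodable.encode z)).bind fun v => Part.ofOption (Encodable.decode v)

/-- The conditional prefix complexity `K(x | y)`: the length of a shortest program from which the
universal self-delimiting machine produces `x` when it is given `y`.  The universal machine reads
a code `e` written as `1 ... 1 0` (with `encode e` ones) and then runs the machine `e`
on the rest of its program. -/
def prefixK (x : α) (y : β) : ℕ :=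
  sInf {l : ℕ | ∃ (e : Nat.Partrec.Code) (p : List Bool),
    l = Encodable.encode e + 1 + p.length ∧ OutputsAfter (selfDelimiting α β e) y p x}

/-- Every object has a program, so the infimum in `prefixK` is attained. -/
theorem prefixK_spec (x : α) (y : β) : ∃ (e : Nat.Partrec.Code) (p : List Bool),
    prefixK x y = Encodable.encode e + 1 + p.length ∧
      OutputsAfter (selfDelimiting α β e) y p x := by
  refine Nat.sInf_mem (s := {l : ℕ | ∃ (e : Nat.Partrec.Code) (p : List Bool),
    l = Encodable.encode e + 1 + p.length ∧ OutputsAfter (selfDelimiting α β e) y p x}) ?_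
  refine ⟨_, Nat.Partrec.Code.const (Encodable.encode (some x)), [], rfl, ?_, ?_⟩
  · simp only [selfDelimiting, Nat.Partrec.Code.eval_const, Part.bind_some, Encodable.encodek]
    simp
  · intro u hu hne
    exact absurd (List.prefix_nil.mp hu) hne

end Kolmogorov

/-! ### Representation systems -/

/-- A representation system over the alphabets `Γ = Fin g` and `Σ = Fin q`: a set of
representations `reps ⊆ Γ*` and a map `concept` from representations to languages over `Σ`. -/
structure RepSystem (g q : ℕ) where
  reps : Set (List (Fin g))
  concept : reps → Set (List (Fin q))

namespace RepSystem

variable {g q : ℕ}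

/-- It is decidable whether a string is a representation, and whether an example belongs to the
concept of a given representation. -/
def Effective (S : RepSystem g q) : Prop :=
  ComputablePred (fun r : List (Fin g) => r ∈ S.reps) ∧
  ComputablePred (fun p : List (Fin g) × List (Fin q) =>
    ∃ h : p.1 ∈ S.reps, p.2 ∈ S.concept ⟨p.1, h⟩)

open Classical in
/-- The example `x` together with its label according to the target `r`. -/
def labelled (S : RepSystem g q) (r : S.reps) (x : List (Fin q)) : List (Fin q) × Bool :=
  (x, decide (x ∈ S.concept r))

/-- The concept `MAJ(r₁, r₂, r₃)`: the strings in at least two of the three concepts. -/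
def maj (S : RepSystem g q) (r₁ r₂ r₃ : S.reps) : Set (List (Fin q)) :=
  (S.concept r₁ ∩ S.concept r₂) ∪ (S.concept r₁ ∩ S.concept r₃) ∪ (S.concept r₂ ∩ S.concept r₃)

end RepSystem

/-- The positive rational number with code `p`.  Accuracy and confidence parameters are handed to
algorithms in this form. -/
def posRat (p : ℕ × ℕ) : ℝ := ((p.1 : ℝ) + 1) / ((p.2 : ℝ) + 1)

/-! ### The algorithms -/

/-- A deterministic learner: on input `(s, n, ε, δ)` it requests labelled examples, one at a time,
and may stop with a string over `Γ`. -/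
abbrev Learner (g q : ℕ) : Type :=
  (ℕ × ℕ × (ℕ × ℕ) × (ℕ × ℕ)) × List (List (Fin q) × Bool) →. Option (List (Fin g))

/-- `L` is a deterministic pac-algorithm for `S` with sample complexity `m n s ε δ`: on every
sequence of examples of length at most `n`, labelled by a target in `R^{≤ s}`, it stops after at
most `m n s ε δ` examples, and when the examples are drawn independently from a probability
distribution `D` on `Σ^{≤ n}`, then with probability at least `1 - δ` the output is a representation
whose concept differs from that of the target on a set of `D`-probability at most `ε`. -/
structure IsDeterministicPac {g q : ℕ} (S : RepSystem g q) (L : Learner g q)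
    (m : ℕ → ℕ → ℝ → ℝ → ℝ) : Prop where
  partrec : Partrec L
  sampleComplexity : ∀ (s n : ℕ), 1 ≤ s → 1 ≤ n → ∀ (ε δ : ℕ × ℕ) (r : S.reps),
    r.1.length ≤ s → ∀ ω : ℕ → List (Fin q), (∀ i, (ω i).length ≤ n) →
      ∃ j : ℕ, (j : ℝ) ≤ m n s (posRat ε) (posRat δ) ∧
        ∃ y, OutputsAfter L (s, n, ε, δ) (firstSymbols (fun i => S.labelled r (ω i)) j) y
  approximates : ∀ (s n : ℕ), 1 ≤ s → 1 ≤ n → ∀ (ε δ : ℕ × ℕ) (r : S.reps),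
    r.1.length ≤ s → ∀ (D : Measure (List (Fin q))) [IsProbabilityMeasure D],
      D {x | n < x.length} = 0 →
      ENNReal.ofReal (1 - posRat δ) ≤ Measure.infinitePi (fun _ : ℕ => D)
        {ω | ∃ (j : ℕ) (r' : S.reps),
          OutputsAfter L (s, n, ε, δ) (firstSymbols (fun i => S.labelled r (ω i)) j) r'.1 ∧
          D (symmDiff (S.concept r') (S.concept r)) ≤ ENNReal.ofReal (posRat ε)}

/-- `M` is a majority-of-three algorithm for `S` with majority expansion function `e`. -/
structure IsMajorityOfThree {g q : ℕ} (S : RepSystem g q)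
    (M : List (Fin g) × List (Fin g) × List (Fin g) →. List (Fin g)) (e : ℕ → ℕ) : Prop where
  partrec : Partrec M
  outputs : ∀ (s : ℕ) (r₁ r₂ r₃ : S.reps),
    r₁.1.length ≤ s → r₂.1.length ≤ s → r₃.1.length ≤ s →
      ∃ r' : S.reps, r'.1 ∈ M (r₁.1, r₂.1, r₃.1) ∧ S.concept r' = S.maj r₁ r₂ r₃ ∧
        r'.1.length ≤ e s

/-- A randomized algorithm that gets `(s, n, γ)` and a labelled sample, tosses coins, and may stop
with a string over `Γ`. -/
abbrev SampleCompressor (g q : ℕ) : Type :=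
  (ℕ × ℕ × (ℕ × ℕ) × List (List (Fin q) × Bool)) × List Bool →. Option (List (Fin g))

/-- The law of an infinite sequence of independent fair coin tosses. -/
def coinTosses : Measure (ℕ → Bool) :=
  Measure.infinitePi (fun _ : ℕ => (PMF.uniformOfFintype Bool).toMeasure)

/-- `A` is a (randomized) Occam algorithm for `S` with compression `f m n s γ`: on a sample of
`m` examples of a target `r ∈ R^{≤ s}`, it outputs with probability at least `1 - γ` a
representation `r'` consistent with the sample such that `K(r' | r, n, s) < m / f m n s γ`,
up to an additive constant that does not depend on the parameters, the target or the sample;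
and `f m n s γ` grows without bound with `m`. -/
structure IsOccam {g q : ℕ} (S : RepSystem g q) (A : SampleCompressor g q)
    (f : ℕ → ℕ → ℕ → ℝ → ℝ) : Prop where
  partrec : Partrec A
  compresses : ∃ C : ℝ, ∀ (s n : ℕ), 1 ≤ s → 1 ≤ n → ∀ (γ : ℕ × ℕ) (r : S.reps),
    r.1.length ≤ s → ∀ xs : List (List (Fin q)), xs ≠ [] → (∀ x ∈ xs, x.length ≤ n) →
      ENNReal.ofReal (1 - posRat γ) ≤ coinTosses
        {ω | ∃ (j : ℕ) (r' : S.reps),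
          OutputsAfter A (s, n, γ, xs.map (S.labelled r)) (firstSymbols ω j) r'.1 ∧
          (∀ x ∈ xs, (x ∈ S.concept r' ↔ x ∈ S.concept r)) ∧
          (prefixK r'.1 (r.1, n, s) : ℝ) < xs.length / f xs.length n s (posRat γ) + C}
  unbounded : ∀ (n s : ℕ), 1 ≤ n → 1 ≤ s → ∀ γ : ℝ, 0 < γ →
    Tendsto (fun k : ℕ => f k n s γ) atTop atTop

/-- The number of bits for one example of length `n` over `q` symbols: `n` if `q ≤ 2`, and
`n log₂ q` in general. -/
def exampleBits (q n : ℕ) : ℝ := n * max 1 (Real.logb 2 q)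

/-- The compression `m / (3 n · m(n, s, 1 / (2 √m), γ / 3))`, with `n` bits counted per example. -/
def majCompression (q : ℕ) (m : ℕ → ℕ → ℝ → ℝ → ℝ) (k n s : ℕ) (γ : ℝ) : ℝ :=
  k / (3 * exampleBits q n * m n s (1 / (2 * √(k : ℝ))) (γ / 3))

end

/-! Since membership is decidable, the first representation of length at most `s` consistent with
the sample can be found by exhaustive search, with success probability one. What has to be shown is
that this output has few bits of information, and the pac-algorithm enters only through the
Vapnik-Chervonenkis dimension `d` of the concepts restricted to `Σ^{≤ n}`.

Every output is the first representation having its own restriction to `Σ^{≤ n}`. These canonical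
representations form a list computable from `s` and `n`, so an output is specified by an index in
that list (`exists_prefixK_le_clog`). By Sauer-Shelah the list has at most `(|Σ^{≤ n}| + 1) ^ d`
members. Conversely, a learner that succeeds with probability above `1/2` must see many points of a
shattered set, since it cannot guess the unseen labels; at accuracy `1/4` this gives `d ≤ 2 m(n, s,
1/4, δ)` (`IsDeterministicPac.card_le_of_shatters`).

A sample of `k ≥ 4` examples has `1 / (2 √k) ≤ 1/4`, so antitonicity turns this into a bound by the
sample complexity in `majCompression`. For `k ≤ 3` the labelled sample itself describes the output.
The little-o hypothesis serves only to make the compression unbounded: with `ε = 1 / (2 √k)`, the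
quantity `k` is `1 / (4 ε²)`. -/

/-! ### Computability of list operations -/

section ComputableLists

variable {α β σ : Type*} [Primcodable α] [Primcodable β] [Primcodable σ]

/-- Recursion on the position: after `k` steps the state is the fold over the first `k` entries. The
remaining list operations are reduced to this one. -/
theorem Computable.list_foldl {f : α → List β} {g : α → σ} {h : α → σ × β → σ}
    (hf : Computable f) (hg : Computable g) (hh : Computable₂ h) :
    Computable fun a => (f a).foldl (fun s b => h a (s, b)) (g a) := by
  have step : Computable₂ fun (a : α) (p : ℕ × σ) =>
      Option.casesOn (motive := fun _ => σ) ((f a)[p.1]?) p.2 (fun b => h a (p.2, b)) :=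
    Computable.option_casesOn
      (Computable.list_getElem?.comp (hf.comp Computable.fst) (Computable.fst.comp Computable.snd))
      (Computable.snd.comp Computable.snd)
      (hh.comp (Computable.fst.comp Computable.fst)
        (Computable.pair (Computable.snd.comp (Computable.snd.comp Computable.fst))
          Computable.snd))
  refine (Computable.nat_rec (Computable.list_length.comp hf) hg step).of_eq fun a => ?_
  have key : ∀ k ≤ (f a).length, (Nat.rec (motive := fun _ => σ) (g a) (fun i s =>
      Option.casesOn (motive := fun _ => σ) ((f a)[i]?) s (fun b => h a (s, b))) k) =
        ((f a).take k).foldl (fun s b => h a (s, b)) (g a) := by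
    intro k
    induction k with
    | zero => intro _; simp
    | succ k ih =>
      intro hk
      have hk' : k < (f a).length := hk
      simp only [ih hk'.le, List.getElem?_eq_getElem hk']
      rw [List.take_add_one, List.getElem?_eq_getElem hk', List.foldl_append]
      rfl
  have := key _ le_rfl
  rw [List.take_length] at this
  exact this

theorem Computable.list_flatMap {f : α → List β} {g : α → β → List σ}
    (hf : Computable f) (hg : Computable₂ g) : Computable fun a => (f a).flatMap (g a) := by
  refine (Computable.list_foldl (h := fun a p => p.1 ++ g a p.2) hf (Computable.const [])
    (Computable.list_append.comp (Computable.fst.comp Computable.snd)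
      (hg.comp Computable.fst (Computable.snd.comp Computable.snd)))).of_eq fun a => ?_
  have key : ∀ (l : List β) (s : List σ),
      l.foldl (fun s b => s ++ g a b) s = s ++ l.flatMap (g a) := by
    intro l
    induction l with
    | nil => simp
    | cons b l ih => intro s; simp [ih]
  simpa using key (f a) []

theorem Computable.list_filterMap {f : α → List β} {g : α → β → Option σ}
    (hf : Computable f) (hg : Computable₂ g) : Computable fun a => (f a).filterMap (g a) := by
  refine (Computable.list_flatMap (g := fun a b => (g a b).toList) hf
    (Primrec.optionToList.to_comp.comp hg)).of_eq fun a => ?_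
  induction f a with
  | nil => simp
  | cons b l ih => cases hb : g a b <;> simp [hb, ih]

theorem Computable.list_filter {f : α → List β} {p : α → β → Bool}
    (hf : Computable f) (hp : Computable₂ p) : Computable fun a => (f a).filter (p a) := by
  refine (Computable.list_filterMap (g := fun a b => bif p a b then some b else none) hf
    (_root_.Computable.cond hp (Computable.option_some.comp Computable.snd)
      (Computable.const none))).of_eq fun a => ?_
  induction f a with
  | nil => simp
  | cons b l ih => cases hb : p a b <;> simp [hb, ih]

theorem Computable.list_find? {f : α → List β} {p : α → β → Bool}
    (hf : Computable f) (hp : Computable₂ p) : Computable fun a => (f a).find? (p a) :=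
  (Computable.list_getElem?.comp (Computable.list_filter hf hp) (Computable.const 0)).of_eq
    fun a => by rw [← List.head?_filter, List.head?_eq_getElem?]

theorem Computable.list_all {f : α → List β} {p : α → β → Bool}
    (hf : Computable f) (hp : Computable₂ p) : Computable fun a => (f a).all (p a) := by
  have hnot : Computable₂ fun a b => !(p a b) := Primrec.not.to_comp.comp hp
  refine (Primrec.not.to_comp.comp (Primrec.option_isSome.to_comp.comp
    (Computable.list_find? hf hnot))).of_eq fun a => ?_
  induction f a with
  | nil => simp
  | cons b l ih => cases hb : p a b <;> simp_all

end ComputableLists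

/-! ### Enumeration of words -/

section Words

/-- The words of length `k` over the letters `P`. -/
def wordsOfLength {α : Type*} (P : List α) : ℕ → List (List α)
  | 0 => [[]]
  | k + 1 => (wordsOfLength P k).flatMap fun w => P.map (· :: w)

/-- The words of length at most `k` over the letters `P`. -/
def wordsUpTo {α : Type*} (P : List α) (k : ℕ) : List (List α) :=
  (List.range (k + 1)).flatMap (wordsOfLength P)

variable {α : Type*} {P : List α}

theorem mem_wordsOfLength {k : ℕ} {w : List α} :
    w ∈ wordsOfLength P k ↔ w.length = k ∧ ∀ a ∈ w, a ∈ P := by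
  induction k generalizing w with
  | zero => cases w <;> simp [wordsOfLength]
  | succ k ih =>
    simp only [wordsOfLength, List.mem_flatMap, List.mem_map, ih]
    constructor
    · rintro ⟨v, ⟨hv, hP⟩, a, ha, rfl⟩
      simp_all
    · rintro ⟨hw, hP⟩
      cases w with
      | nil => simp at hw
      | cons a v =>
        exact ⟨v, ⟨by simpa using hw, fun b hb => hP b (by simp [hb])⟩, a, hP a (by simp), rfl⟩

theorem mem_wordsUpTo {k : ℕ} {w : List α} :
    w ∈ wordsUpTo P k ↔ w.length ≤ k ∧ ∀ a ∈ w, a ∈ P := by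
  simp [wordsUpTo, mem_wordsOfLength]

theorem length_wordsOfLength (k : ℕ) : (wordsOfLength P k).length = P.length ^ k := by
  induction k with
  | zero => rfl
  | succ k ih => simp [wordsOfLength, List.length_flatMap, ih, pow_succ]

theorem length_wordsUpTo (k : ℕ) :
    (wordsUpTo P k).length = ∑ i ∈ Finset.range (k + 1), P.length ^ i := by
  simp only [wordsUpTo, List.length_flatMap, length_wordsOfLength]
  rw [Finset.sum_range, ← List.sum_ofFn, List.ofFn_eq_map, ← List.map_coe_finRange_eq_range,
    List.map_map]
  rfl

theorem nodup_wordsOfLength (hP : P.Nodup) (k : ℕ) : (wordsOfLength P k).Nodup := by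
  induction k with
  | zero => simp [wordsOfLength]
  | succ k ih =>
    refine List.nodup_flatMap.2 ⟨fun w _ => hP.map fun a b h => (List.cons.inj h).1, ?_⟩
    refine ih.imp fun {v w} hvw => ?_
    simp only [Function.onFun]
    rw [List.disjoint_left]
    intro x hx hx'
    obtain ⟨a, -, rfl⟩ := List.mem_map.1 hx
    obtain ⟨b, -, hb⟩ := List.mem_map.1 hx'
    exact hvw (List.cons.inj hb).2.symm

theorem nodup_wordsUpTo (hP : P.Nodup) (k : ℕ) : (wordsUpTo P k).Nodup := by
  refine List.nodup_flatMap.2 ⟨fun i _ => nodup_wordsOfLength hP i, ?_⟩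
  refine List.nodup_range.imp fun {i j} hij => ?_
  simp only [Function.onFun]
  rw [List.disjoint_left]
  intro x hx hx'
  exact hij ((mem_wordsOfLength.1 hx).1.symm.trans (mem_wordsOfLength.1 hx').1)

theorem mem_wordsUpTo_finRange {q k : ℕ} {w : List (Fin q)} :
    w ∈ wordsUpTo (List.finRange q) k ↔ w.length ≤ k := by
  simp [mem_wordsUpTo]

/-- Termwise comparison with the binomial expansion, whose coefficients are at least one. It serves
both for counting words and for the Sauer-Shelah sum. -/
theorem sum_range_pow_le (p k : ℕ) : ∑ i ∈ Finset.range (k + 1), p ^ i ≤ (p + 1) ^ k := by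
  rw [add_pow]
  refine Finset.sum_le_sum fun i hi => ?_
  have : 0 < k.choose i := Nat.choose_pos (Nat.lt_succ_iff.1 (Finset.mem_range.1 hi))
  simpa using Nat.le_mul_of_pos_right (p ^ i) this

theorem primrec_wordsOfLength [Primcodable α] :
    Primrec₂ fun (P : List α) (k : ℕ) => wordsOfLength P k := by
  have step : Primrec₂ fun (P : List α) (p : ℕ × List (List α)) =>
      p.2.flatMap fun w => P.map (· :: w) :=
    Primrec.list_flatMap (Primrec.snd.comp Primrec.snd)
      (Primrec.list_map (Primrec.fst.comp Primrec.fst)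
        (Primrec.list_cons.comp Primrec.snd (Primrec.snd.comp Primrec.fst)))
  refine (Primrec.nat_rec (Primrec.const [[]]) step).of_eq fun P k => ?_
  induction k with
  | zero => rfl
  | succ k ih => simp only [wordsOfLength, ← ih]

theorem primrec_wordsUpTo [Primcodable α] :
    Primrec₂ fun (P : List α) (k : ℕ) => wordsUpTo P k :=
  Primrec.list_flatMap (Primrec.list_range.comp (Primrec.succ.comp Primrec.snd))
    (primrec_wordsOfLength.comp (Primrec.fst.comp Primrec.fst) Primrec.snd)

end Words

/-! ### Prefix complexity of the members of a computable list -/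

section PrefixComplexity

variable {α β : Type} [Primcodable α] [Primcodable β]

/-- The number with the given binary expansion. -/
def binaryValue (p : List Bool) : ℕ := p.foldl (fun v b => 2 * v + b.toNat) 0

/-- Leading zeros are allowed, so every index has a word of exactly `l` bits; the fixed length is
what makes the programs below self-delimiting. -/
theorem exists_binaryValue_eq (l : ℕ) : ∀ i < 2 ^ l,
    ∃ p : List Bool, p.length = l ∧ binaryValue p = i := by
  induction l with
  | zero => intro i hi; exact ⟨[], rfl, by simp_all [binaryValue]⟩
  | succ l ih =>
    intro i hi
    obtain ⟨p, hp, hv⟩ := ih (i / 2) (by rw [pow_succ] at hi; omega)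
    refine ⟨p ++ [i % 2 == 1], by simp [hp], ?_⟩
    have hv' : List.foldl (fun v (b : Bool) => 2 * v + b.toNat) 0 p = i / 2 := hv
    simp only [binaryValue, List.foldl_append, hv', List.foldl_cons, List.foldl_nil]
    rcases Nat.mod_two_eq_zero_or_one i with h | h <;> simp [h] <;> omega

theorem computable_binaryValue : Computable binaryValue := by
  have htoNat : Primrec Bool.toNat := Primrec.dom_finite _
  have step : Computable₂ fun (_ : List Bool) (p : ℕ × Bool) => 2 * p.1 + p.2.toNat :=
    (Primrec.nat_add.comp
      (Primrec.nat_mul.comp (Primrec.const 2) (Primrec.fst.comp Primrec.snd))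
      (htoNat.comp (Primrec.snd.comp Primrec.snd))).to_comp
  exact Computable.list_foldl Computable.id (Computable.const 0) step

theorem primrec_two_pow : Primrec fun k : ℕ => 2 ^ k := by
  refine (Primrec.nat_rec₁ 1 (f := fun _ v => 2 * v)
    (Primrec.nat_mul.comp (Primrec.const 2) Primrec.snd)).of_eq fun k => ?_
  induction k with
  | zero => rfl
  | succ k ih => rw [pow_succ, ← ih, mul_comm]

theorem exists_selfDelimiting_eq {G : β × List Bool → Option α} (hG : Computable G) :
    ∃ e : Nat.Partrec.Code, ∀ z, selfDelimiting α β e z = Part.some (G z) := by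
  obtain ⟨e, he⟩ := Nat.Partrec.Code.exists_code.1 hG
  refine ⟨e, fun z => ?_⟩
  simp [selfDelimiting, he]

/-- The members of a computable finite list have prefix complexity at most the binary logarithm of
its length. -/
theorem exists_prefixK_le_clog {F : β → List α} (hF : Computable F) :
    ∃ C : ℕ, ∀ (y : β), ∀ x ∈ F y, prefixK x y ≤ Nat.clog 2 (F y).length + C := by
  have hlt : Computable fun z : β × List Bool => decide (2 ^ z.2.length < (F z.1).length) :=
    Primrec.nat_lt.decide.to_comp.comp
      (primrec_two_pow.to_comp.comp (Computable.list_length.comp Computable.snd))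
      (Computable.list_length.comp (hF.comp Computable.fst))
  -- The machine computes the list from the condition, requests bits until there are enough to
  -- address every entry, and then reads them as an index.
  have hG : Computable fun z : β × List Bool =>
      bif decide (2 ^ z.2.length < (F z.1).length) then none else (F z.1)[binaryValue z.2]? :=
    Computable.cond hlt (Computable.const none)
      (Computable.list_getElem?.comp (hF.comp Computable.fst)
        (computable_binaryValue.comp Computable.snd))
  obtain ⟨e, he⟩ := exists_selfDelimiting_eq hG
  -- The constant pays for the unary header that names the machine.
  refine ⟨Encodable.encode e + 1, fun y x hx => ?_⟩
  obtain ⟨i, hi, rfl⟩ := List.getElem_of_mem hx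
  have hpow := Nat.le_pow_clog one_lt_two (F y).length
  obtain ⟨p, hp, hv⟩ := exists_binaryValue_eq _ i (hi.trans_le hpow)
  refine Nat.sInf_le ⟨e, p, by omega, ?_, fun u hu hne => ?_⟩
  · rw [he]
    simp [hp, hv, hi, not_lt.2 hpow]
  · have hlen : u.length < Nat.clog 2 (F y).length :=
      hp ▸ lt_of_le_of_ne hu.length_le fun h => hne (hu.eq_of_length h)
    rw [he]
    simp [(Nat.lt_clog_iff_pow_lt one_lt_two).1 hlen]

end PrefixComplexity

/-! ### The Sauer-Shelah bound -/

/-- Pajor's form of Sauer-Shelah: a family has at most as many members as shattered sets, and the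
latter are subsets of `U` of size at most the dimension. -/
theorem Finset.card_le_pow_vcDim {α : Type*} [DecidableEq α] {𝒜 : Finset (Finset α)} {U : Finset α}
    (h : ∀ A ∈ 𝒜, A ⊆ U) : 𝒜.card ≤ (U.card + 1) ^ 𝒜.vcDim := by
  have hsub : 𝒜.shatterer ⊆
      (Finset.range (𝒜.vcDim + 1)).biUnion fun i => U.powersetCard i := by
    intro A hA
    have hA' := Finset.mem_shatterer.1 hA
    obtain ⟨B, hB, hAB⟩ := hA'.exists_superset
    exact Finset.mem_biUnion.2 ⟨A.card, Finset.mem_range.2 (Nat.lt_succ_iff.2 hA'.card_le_vcDim),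
      Finset.mem_powersetCard.2 ⟨hAB.trans (h B hB), rfl⟩⟩
  calc 𝒜.card ≤ 𝒜.shatterer.card := 𝒜.card_le_card_shatterer
    _ ≤ ∑ i ∈ Finset.range (𝒜.vcDim + 1), (U.powersetCard i).card :=
      (Finset.card_le_card hsub).trans Finset.card_biUnion_le
    _ ≤ ∑ i ∈ Finset.range (𝒜.vcDim + 1), U.card ^ i :=
      Finset.sum_le_sum fun i _ => by
        rw [Finset.card_powersetCard]; exact Nat.choose_le_pow _ _
    _ ≤ _ := sum_range_pow_le _ _

theorem List.find?_eq_some_of_imp {α : Type*} {l : List α} {p p' : α → Bool} {a : α}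
    (h : l.find? p = some a) (ha : p' a = true) (himp : ∀ b, p' b = true → p b = true) :
    l.find? p' = some a := by
  obtain ⟨-, u, v, hl, hu⟩ := List.find?_eq_some_iff_append.1 h
  refine List.find?_eq_some_iff_append.2 ⟨ha, u, v, hl, fun b hb => ?_⟩
  by_contra hc
  have hpb : p b = true := himp b (by simpa using hc)
  simpa [hpb] using hu b hb

/-! ### Canonical representations and traces of concepts -/

namespace RepSystem

variable {g q : ℕ} (S : RepSystem g q)

open Classical in
/-- The label of the example `x` according to the string `r`; it is `false` if `r` is not a
representation. -/
noncomputable def label (r : List (Fin g)) (x : List (Fin q)) : Bool :=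
  decide (∃ h : r ∈ S.reps, x ∈ S.concept ⟨r, h⟩)

open Classical in
/-- The string `r` is a representation and agrees with the labelled examples `l`. -/
noncomputable def consistent (l : List (List (Fin q) × Bool)) (r : List (Fin g)) : Bool :=
  decide (r ∈ S.reps) && l.all fun p => S.label r p.1 == p.2

/-- The first representation of length at most `s` that agrees with the labelled examples `l`. -/
noncomputable def firstConsistent (s : ℕ) (l : List (List (Fin q) × Bool)) :
    Option (List (Fin g)) :=
  (wordsUpTo (List.finRange g) s).find? (S.consistent l)

/-- All examples of length at most `n`, labelled according to `r`. -/
noncomputable def fullSample (n : ℕ) (r : List (Fin g)) : List (List (Fin q) × Bool) :=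
  (wordsUpTo (List.finRange q) n).map fun x => (x, S.label r x)

/-- The representations of length at most `s` that are the first ones for their restrictions
to `Σ^{≤ n}`. -/
noncomputable def canonicalReps (s n : ℕ) : List (List (Fin g)) :=
  (wordsUpTo (List.finRange g) s).filter fun r =>
    decide (S.firstConsistent s (S.fullSample n r) = some r)

/-- The labelled examples of length at most `n`. -/
def labelledWords (q n : ℕ) : List (List (Fin q) × Bool) :=
  (wordsUpTo (List.finRange q) n).flatMap fun x => [(x, true), (x, false)]

/-- The first consistent representations for the samples of at most `k` examples. -/
noncomputable def smallSampleReps (k s n : ℕ) : List (List (Fin g)) :=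
  (wordsUpTo (labelledWords q n) k).filterMap (S.firstConsistent s)

/-- The strings of length at most `n`. -/
def shortStrings (q n : ℕ) : Finset (List (Fin q)) := (wordsUpTo (List.finRange q) n).toFinset

open Classical in
/-- The restrictions to `Σ^{≤ n}` of the concepts with representations of length at most `s`. -/
noncomputable def traces (s n : ℕ) : Finset (Finset (List (Fin q))) :=
  ((wordsUpTo (List.finRange g) s).toFinset.filter (· ∈ S.reps)).image fun r =>
    (shortStrings q n).filter fun x => S.label r x = true

variable {S}

theorem mem_shortStrings {n : ℕ} {x : List (Fin q)} : x ∈ shortStrings q n ↔ x.length ≤ n := by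
  simp [shortStrings, mem_wordsUpTo_finRange]

theorem length_wordsUpTo_finRange (n : ℕ) :
    (wordsUpTo (List.finRange q) n).length = (shortStrings q n).card :=
  (List.toFinset_card_of_nodup (nodup_wordsUpTo (List.nodup_finRange q) n)).symm

theorem label_eq_true {r : S.reps} {x : List (Fin q)} :
    S.label r.1 x = true ↔ x ∈ S.concept r := by
  simp [label]

theorem labelled_eq (r : S.reps) (x : List (Fin q)) : S.labelled r x = (x, S.label r.1 x) := by
  simp [labelled, label]

theorem consistent_iff {l : List (List (Fin q) × Bool)} {r : List (Fin g)} :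
    S.consistent l r = true ↔ r ∈ S.reps ∧ ∀ p ∈ l, S.label r p.1 = p.2 := by
  simp [consistent]

theorem consistent_map_labelled {xs : List (List (Fin q))} {r r' : S.reps} :
    S.consistent (xs.map (S.labelled r)) r'.1 = true ↔
      ∀ x ∈ xs, (x ∈ S.concept r' ↔ x ∈ S.concept r) := by
  simp only [consistent_iff, List.mem_map, labelled_eq, forall_exists_index, and_imp,
    forall_apply_eq_imp_iff₂, r'.2, true_and]
  refine forall₂_congr fun x _ => ?_
  rw [Bool.eq_iff_iff, label_eq_true, label_eq_true]

/-! #### The first consistent representation -/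

theorem exists_firstConsistent {s : ℕ} {r : S.reps} (hr : r.1.length ≤ s)
    (xs : List (List (Fin q))) : ∃ r' : S.reps,
      S.firstConsistent s (xs.map (S.labelled r)) = some r'.1 ∧
      ∀ x ∈ xs, (x ∈ S.concept r' ↔ x ∈ S.concept r) := by
  obtain ⟨a, ha⟩ := Option.isSome_iff_exists.1 (List.find?_isSome.2
    ⟨r.1, mem_wordsUpTo_finRange.2 hr,
      (consistent_map_labelled (r := r) (r' := r) (xs := xs)).2 fun _ _ => Iff.rfl⟩)
  have hc := List.find?_some ha
  exact ⟨⟨a, (consistent_iff.1 hc).1⟩, ha, consistent_map_labelled.1 hc⟩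

/-- Agreeing with the output on all of `Σ^{≤ n}` implies agreeing with the sample, so any earlier
word with the same restriction would already have been found by the search. -/
theorem firstConsistent_mem_canonicalReps {s n : ℕ} {r : S.reps} {xs : List (List (Fin q))}
    (hxs : ∀ x ∈ xs, x.length ≤ n) {r' : List (Fin g)}
    (h : S.firstConsistent s (xs.map (S.labelled r)) = some r') : r' ∈ S.canonicalReps s n := by
  refine List.mem_filter.2 ⟨List.mem_of_find?_eq_some h, decide_eq_true ?_⟩
  have hc := consistent_iff.1 (List.find?_some h)
  refine List.find?_eq_some_of_imp h (consistent_iff.2 ⟨hc.1, ?_⟩) fun b hb => ?_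
  · intro p hp
    obtain ⟨x, -, rfl⟩ := List.mem_map.1 hp
    rfl
  · have hb' := consistent_iff.1 hb
    refine consistent_iff.2 ⟨hb'.1, fun p hp => ?_⟩
    rw [← hc.2 p hp]
    obtain ⟨x, hx, rfl⟩ := List.mem_map.1 hp
    exact hb'.2 _ (List.mem_map.2 ⟨x, mem_wordsUpTo_finRange.2 (hxs x hx), rfl⟩)

theorem firstConsistent_mem_smallSampleReps {k s n : ℕ} {r : S.reps} {xs : List (List (Fin q))}
    (hk : xs.length ≤ k) (hxs : ∀ x ∈ xs, x.length ≤ n) {r' : List (Fin g)}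
    (h : S.firstConsistent s (xs.map (S.labelled r)) = some r') :
    r' ∈ S.smallSampleReps k s n := by
  refine List.mem_filterMap.2 ⟨_, mem_wordsUpTo.2 ⟨by simpa using hk, fun p hp => ?_⟩, h⟩
  obtain ⟨x, hx, rfl⟩ := List.mem_map.1 hp
  refine List.mem_flatMap.2 ⟨x, mem_wordsUpTo_finRange.2 (hxs x hx), ?_⟩
  rw [labelled_eq]
  cases S.label r.1 x <;> simp

theorem length_smallSampleReps_le (k s n : ℕ) :
    (S.smallSampleReps k s n).length ≤ (2 * (shortStrings q n).card + 1) ^ k := by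
  refine (List.length_filterMap_le _ _).trans ?_
  rw [length_wordsUpTo]
  refine (sum_range_pow_le _ _).trans (le_of_eq ?_)
  simp [labelledWords, List.length_flatMap, length_wordsUpTo_finRange, mul_comm]

/-- A canonical representation is recovered from its trace as the first one consistent with it, so
taking traces is injective. -/
theorem length_canonicalReps_le (s n : ℕ) : (S.canonicalReps s n).length ≤ (S.traces s n).card := by
  classical
  have hnodup : (S.canonicalReps s n).Nodup :=
    (nodup_wordsUpTo (List.nodup_finRange g) s).filter _
  rw [← List.toFinset_card_of_nodup hnodup]
  refine Finset.card_le_card_of_injOn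
    (fun r => (shortStrings q n).filter fun x => S.label r x = true) ?_ ?_
  · intro r hr
    have hr' := List.mem_filter.1 (List.mem_toFinset.1 hr)
    refine Finset.mem_image_of_mem _ (Finset.mem_filter.2 ⟨List.mem_toFinset.2 hr'.1, ?_⟩)
    exact (consistent_iff.1 (List.find?_some (of_decide_eq_true hr'.2))).1
  · intro r hr r' hr' heq
    have h1 := of_decide_eq_true (List.mem_filter.1 (List.mem_toFinset.1 hr)).2
    have h2 := of_decide_eq_true (List.mem_filter.1 (List.mem_toFinset.1 hr')).2
    have : S.fullSample n r = S.fullSample n r' := by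
      refine List.map_congr_left fun x hx => ?_
      have := Finset.ext_iff.1 heq x
      simp only [Finset.mem_filter, mem_shortStrings, mem_wordsUpTo_finRange.1 hx, true_and] at this
      rw [Bool.eq_iff_iff.2 this]
    rw [this, h2] at h1
    exact (Option.some.inj h1).symm

theorem subset_of_mem_traces {s n : ℕ} {A : Finset (List (Fin q))} (hA : A ∈ S.traces s n) :
    A ⊆ shortStrings q n := by
  obtain ⟨r, -, rfl⟩ := Finset.mem_image.1 hA
  exact Finset.filter_subset _ _

theorem length_canonicalReps_le_pow_vcDim (s n : ℕ) :
    (S.canonicalReps s n).length ≤ ((shortStrings q n).card + 1) ^ (S.traces s n).vcDim :=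
  (length_canonicalReps_le s n).trans (Finset.card_le_pow_vcDim fun _ => subset_of_mem_traces)

theorem length_canonicalReps_le_two_pow (s n : ℕ) :
    (S.canonicalReps s n).length ≤ 2 ^ (shortStrings q n).card := by
  refine (length_canonicalReps_le s n).trans ?_
  rw [← Finset.card_powerset]
  exact Finset.card_le_card fun A hA => Finset.mem_powerset.2 (subset_of_mem_traces hA)

/-! #### Computability -/

theorem Effective.computable_label (hS : S.Effective) :
    Computable₂ fun (r : List (Fin g)) (x : List (Fin q)) => S.label r x := by
  obtain ⟨_, h⟩ := hS.2
  refine Computable.of_eq h fun p => ?_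
  simp [label]

theorem Effective.computable_firstConsistent (hS : S.Effective) :
    Computable₂ S.firstConsistent := by
  classical
  have hreps : Computable fun r : List (Fin g) => decide (r ∈ S.reps) := by
    obtain ⟨_, h⟩ := hS.1
    exact h.of_eq fun r => by simp
  have hbeq : Computable₂ fun b b' : Bool => b == b' := Primrec.beq.to_comp
  have hcons : Computable₂ S.consistent :=
    Primrec.and.to_comp.comp (hreps.comp Computable.snd)
      (Computable.list_all Computable.fst
        (hbeq.comp
          (hS.computable_label.comp (Computable.snd.comp Computable.fst)
            (Computable.fst.comp Computable.snd))
          (Computable.snd.comp Computable.snd)))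
  exact Computable.list_find?
    (primrec_wordsUpTo.to_comp.comp (Computable.const _) Computable.fst)
    (hcons.comp (Computable.snd.comp Computable.fst) Computable.snd)

theorem Effective.computable_canonicalReps (hS : S.Effective) :
    Computable₂ S.canonicalReps := by
  have hfull : Computable₂ S.fullSample := by
    have hwords : Computable fun z : ℕ × List (Fin g) => wordsUpTo (List.finRange q) z.1 :=
      primrec_wordsUpTo.to_comp.comp (Computable.const _) Computable.fst
    refine (Computable.list_filterMap (g := fun z x => some (x, S.label z.2 x)) hwords
      (Computable.option_some.comp (Computable.snd.pair
        (hS.computable_label.comp (Computable.snd.comp Computable.fst)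
          Computable.snd)))).of_eq fun z => ?_
    simp [fullSample]
  have heq : Computable₂ fun a b : Option (List (Fin g)) => decide (a = b) :=
    Primrec.eq.decide.to_comp
  exact Computable.list_filter
    (primrec_wordsUpTo.to_comp.comp (Computable.const _) Computable.fst)
    (heq.comp
      (hS.computable_firstConsistent.comp (Computable.fst.comp Computable.fst)
        (hfull.comp (Computable.snd.comp Computable.fst) Computable.snd))
      (Computable.option_some.comp Computable.snd))

theorem primrec_labelledWords : Primrec (labelledWords q) := by
  have : Primrec fun x : List (Fin q) => [(x, true), (x, false)] :=
    Primrec.list_cons.comp (Primrec.id.pair (Primrec.const true))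
      (Primrec.list_cons.comp (Primrec.id.pair (Primrec.const false)) (Primrec.const []))
  exact Primrec.list_flatMap (primrec_wordsUpTo.comp (Primrec.const _) Primrec.id)
    (this.comp Primrec.snd)

theorem Effective.computable_smallSampleReps (hS : S.Effective) (k : ℕ) :
    Computable₂ (S.smallSampleReps k) :=
  Computable.list_filterMap
    (primrec_wordsUpTo.to_comp.comp (primrec_labelledWords.to_comp.comp Computable.snd)
      (Computable.const k))
    (hS.computable_firstConsistent.comp (Computable.fst.comp Computable.fst) Computable.snd)

end RepSystem

/-! ### A lower bound for the sample complexity -/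

/-- If one run stopped earlier than the other along the same sequence, the procedure would at that
point both stop and request a symbol. -/
theorem OutputsAfter.unique {α β ρ : Type} {A : α × List β →. Option ρ} {a : α} {ω : ℕ → β}
    {j j' : ℕ} {y y' : ρ} (h : OutputsAfter A a (firstSymbols ω j) y)
    (h' : OutputsAfter A a (firstSymbols ω j') y') : j = j' ∧ y = y' := by
  have aux : ∀ {i i' : ℕ} {z z' : ρ}, OutputsAfter A a (firstSymbols ω i) z →
      OutputsAfter A a (firstSymbols ω i') z' → ¬ i < i' := by
    intro i i' z z' hz hz' hi
    have hpre : firstSymbols ω i <+: firstSymbols ω i' := by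
      refine List.IsPrefix.map _ ⟨(List.range (i' - i)).map (i + ·), ?_⟩
      rw [← List.range_add, Nat.add_sub_cancel' hi.le]
    have hne : firstSymbols ω i ≠ firstSymbols ω i' := fun he => by
      have := congrArg List.length he
      simp [firstSymbols] at this
      omega
    exact Option.some_ne_none z (Part.mem_unique hz.1 (hz'.2 _ hpre hne))
  obtain rfl : j = j' := le_antisymm (not_lt.1 (aux h' h)) (not_lt.1 (aux h h'))
  exact ⟨rfl, Option.some.inj (Part.mem_unique h.1 h'.1)⟩

theorem firstSymbols_congr {β : Type} {ω ω' : ℕ → β} {j : ℕ} (h : ∀ i < j, ω i = ω' i) :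
    firstSymbols ω j = firstSymbols ω' j :=
  List.map_congr_left fun i hi => h i (List.mem_range.1 hi)

namespace RepSystem

variable {g q : ℕ} {S : RepSystem g q}

/-- Every subset of a shattered set is cut out by the concept of a short representation. -/
theorem exists_rep_of_shatters {s n : ℕ} {Y : Finset (List (Fin q))}
    (hY : (S.traces s n).Shatters Y) (b : Finset (List (Fin q))) :
    ∃ r : S.reps, r.1.length ≤ s ∧ ∀ x ∈ Y, (x ∈ S.concept r ↔ x ∈ b) := by
  classical
  obtain ⟨u, hu, hub⟩ := hY (Finset.inter_subset_left (s₁ := Y) (s₂ := b))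
  obtain ⟨B, hB, hYB⟩ := hY.exists_superset
  obtain ⟨r, hr, rfl⟩ := Finset.mem_image.1 hu
  obtain ⟨hr, hrS⟩ := Finset.mem_filter.1 hr
  refine ⟨⟨r, hrS⟩, mem_wordsUpTo_finRange.1 (List.mem_toFinset.1 hr), fun x hx => ?_⟩
  have := Finset.ext_iff.1 hub x
  simp only [Finset.mem_inter, hx, true_and, Finset.mem_filter,
    subset_of_mem_traces hB (hYB hx)] at this
  rw [← this, ← label_eq_true]

open Classical in
/-- For a fixed sequence of examples from `Y`, a learner that sees at most `N` of them approximates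
at most half of the labellings of `Y` up to `K` errors, if `N + 2 * K < |Y|`. -/
theorem two_mul_card_approximated_le {ι : Type}
    {L : ι × List (List (Fin q) × Bool) →. Option (List (Fin g))}
    {a : ι} {Y : Finset (List (Fin q))} {rep : Finset (List (Fin q)) → S.reps}
    (hrep : ∀ b, ∀ x ∈ Y, (x ∈ S.concept (rep b) ↔ x ∈ b)) {N : ℝ} {K : ℕ}
    (hNK : N + 2 * K < Y.card) {ω : ℕ → List (Fin q)} (hω : ∀ i, ω i ∈ Y)
    (hhalts : ∀ b, ∃ j : ℕ, (j : ℝ) ≤ N ∧ ∃ y,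
      OutputsAfter L a (firstSymbols (fun i => S.labelled (rep b) (ω i)) j) y) :
    2 * (Y.powerset.filter fun b => ∃ (j : ℕ) (r' : S.reps),
      OutputsAfter L a (firstSymbols (fun i => S.labelled (rep b) (ω i)) j) r'.1 ∧
      (Y.filter fun x => x ∈ symmDiff (S.concept r') (S.concept (rep b))).card ≤ K).card
        ≤ 2 ^ Y.card := by
  choose J hJN y hy using hhalts
  set good : Finset (List (Fin q)) → Prop := fun b => ∃ (j : ℕ) (r' : S.reps),
      OutputsAfter L a (firstSymbols (fun i => S.labelled (rep b) (ω i)) j) r'.1 ∧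
      (Y.filter fun x => x ∈ symmDiff (S.concept r') (S.concept (rep b))).card ≤ K
  let seen : Finset (List (Fin q)) → Finset (List (Fin q)) := fun b =>
    (Finset.range (J b)).image ω
  -- Complement the labels at exactly the points of `Y` that the run on `b` never sees. The learner
  -- cannot distinguish `b` from `flip b`.
  let flip : Finset (List (Fin q)) → Finset (List (Fin q)) := fun b => symmDiff b (Y \ seen b)
  have hrun : ∀ b, J (flip b) = J b ∧ y (flip b) = y b := by
    intro b
    have hlab : firstSymbols (fun i => S.labelled (rep b) (ω i)) (J b) =
        firstSymbols (fun i => S.labelled (rep (flip b)) (ω i)) (J b) := by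
      refine firstSymbols_congr fun i hi => ?_
      have hmem : ω i ∈ seen b := Finset.mem_image_of_mem _ (Finset.mem_range.2 hi)
      simp only [labelled]
      congr 1
      rw [decide_eq_decide, hrep _ _ (hω i), hrep _ _ (hω i), Finset.mem_symmDiff]
      simp [hmem]
    have := hy b
    rw [hlab] at this
    exact (hy (flip b)).unique this
  -- The two runs stop at the same time, so they leave the same points unseen, and `flip` is an
  -- involution.
  have hflip : ∀ b, flip (flip b) = b := fun b => by
    simp only [flip, seen] at hrun ⊢
    rw [(hrun b).1, symmDiff_symmDiff_cancel_right]
  have hsub : ∀ b ∈ Y.powerset, flip b ∈ Y.powerset := fun b hb => by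
    rw [Finset.mem_powerset] at hb ⊢
    intro x hx
    rcases Finset.mem_symmDiff.1 hx with h | h
    · exact hb h.1
    · exact (Finset.mem_sdiff.1 h.1).1
  have hbad : ∀ b, good b → ¬ good (flip b) := by
    rintro b ⟨j, r', hout, herr⟩ ⟨j', r'', hout', herr'⟩
    have h1 := (hout.unique (hy b)).2
    have h2 := (hout'.unique (hy (flip b))).2
    obtain rfl : r' = r'' := Subtype.ext (by rw [h1, h2, (hrun b).2])
    -- The common output is wrong at each unseen point for one of the two targets. If both errors
    -- were at most `K`, at most `2 * K` points would be unseen.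
    have hcover : Y \ seen b ⊆
        (Y.filter fun x => x ∈ symmDiff (S.concept r') (S.concept (rep b))) ∪
        (Y.filter fun x => x ∈ symmDiff (S.concept r') (S.concept (rep (flip b)))) := by
      intro x hx
      have hxY := (Finset.mem_sdiff.1 hx).1
      have hxf : x ∈ flip b ↔ x ∉ b := by
        rw [Finset.mem_symmDiff]; tauto
      simp only [Finset.mem_union, Finset.mem_filter, hxY, true_and, Set.mem_symmDiff,
        hrep _ x hxY, hxf]
      tauto
    have hcard := (Finset.card_le_card hcover).trans (Finset.card_union_le _ _)
    have hseen : (seen b).card ≤ J b := Finset.card_image_le.trans (Finset.card_range _).le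
    have hdiff := Finset.le_card_sdiff (seen b) Y
    have hle : Y.card ≤ J b + 2 * K := by omega
    have : (Y.card : ℝ) ≤ J b + 2 * K := by exact_mod_cast hle
    linarith [hJN b]
  have hcard : (Y.powerset.filter good).card ≤ (Y.powerset.filter fun b => ¬ good b).card := by
    refine Finset.card_le_card_of_injOn flip ?_ ?_
    · intro b hb
      have hb' := Finset.mem_filter.1 hb
      exact Finset.mem_filter.2 ⟨hsub b hb'.1, hbad b hb'.2⟩
    · intro b _ b' _ h
      rw [← hflip b, ← hflip b', h]
  have := Finset.card_filter_add_card_filter_not (s := Y.powerset) good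
  rw [Finset.card_powerset] at this
  have hhalf : 2 * (Y.powerset.filter good).card ≤ 2 ^ Y.card := by omega
  convert hhalf

end RepSystem

theorem firstSymbols_eq_ofFn {β : Type} (ω : ℕ → β) (j : ℕ) :
    firstSymbols ω j = List.ofFn fun i : Fin j => ω i := by
  rw [firstSymbols, List.ofFn_eq_map, ← List.map_coe_finRange_eq_range, List.map_map]
  rfl

/-- The event depends on finitely many coordinates, and every set of tuples of strings is countable.
-/
theorem measurableSet_of_firstSymbols {q : ℕ} {β : Type} (φ : List (Fin q) → β) (j : ℕ)
    (P : List β → Prop) :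
    MeasurableSet {ω : ℕ → List (Fin q) | P (firstSymbols (fun i => φ (ω i)) j)} := by
  have hmeas : Measurable fun (ω : ℕ → List (Fin q)) (i : Fin j) => ω i :=
    measurable_pi_lambda _ fun i => measurable_pi_apply _
  have : MeasurableSet {v : Fin j → List (Fin q) | P (List.ofFn fun i => φ (v i))} :=
    (Set.to_countable _).measurableSet
  simpa only [firstSymbols_eq_ofFn] using! hmeas this

/-- The sample complexity of a pac-algorithm is bounded below by the size of shattered sets. -/
theorem IsDeterministicPac.card_le_of_shatters {g q : ℕ} {S : RepSystem g q} {L : Learner g q}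
    {m : ℕ → ℕ → ℝ → ℝ → ℝ} (hL : IsDeterministicPac S L m) {s n : ℕ} (hs : 1 ≤ s) (hn : 1 ≤ n)
    (ε δ : ℕ × ℕ) (hδ : posRat δ < 1 / 2) {Y : Finset (List (Fin q))} (hne : Y.Nonempty)
    (hY : (S.traces s n).Shatters Y) :
    (Y.card : ℝ) ≤ m n s (posRat ε) (posRat δ) + 2 * ⌊posRat ε * Y.card⌋₊ := by
  classical
  by_contra! hlt
  choose rep hlen hrep using S.exists_rep_of_shatters hY
  have hYn : ∀ x ∈ Y, x.length ≤ n := by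
    obtain ⟨B, hB, hYB⟩ := hY.exists_superset
    exact fun x hx => RepSystem.mem_shortStrings.1 (RepSystem.subset_of_mem_traces hB (hYB hx))
  -- Under the uniform distribution on `Y`, error at most `ε` means at most `⌊ε |Y|⌋` wrong points,
  -- which is the `K` of the counting lemma.
  let D : Measure (List (Fin q)) := (PMF.uniformOfFinset Y hne).toMeasure
  have hD : ∀ t : Set (List (Fin q)), D t = (Y.filter (· ∈ t)).card / Y.card := fun t =>
    PMF.toMeasure_uniformOfFinset_apply hne t trivial
  have hε : 0 < posRat ε := by unfold posRat; positivity
  have hYpos : (0 : ℝ) < Y.card := by exact_mod_cast hne.card_pos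
  have hDle : ∀ t : Set (List (Fin q)), D t ≤ ENNReal.ofReal (posRat ε) →
      (Y.filter (· ∈ t)).card ≤ ⌊posRat ε * Y.card⌋₊ := by
    intro t ht
    refine Nat.le_floor ?_
    have hreal : ((Y.filter (· ∈ t)).card : ℝ≥0∞) / Y.card =
        ENNReal.ofReal ((Y.filter (· ∈ t)).card / Y.card) := by
      rw [ENNReal.ofReal_div_of_pos hYpos]; simp
    rw [hD, hreal, ENNReal.ofReal_le_ofReal_iff hε.le, div_le_iff₀ hYpos] at ht
    exact ht
  have hDzero : ∀ t : Set (List (Fin q)), (∀ x ∈ Y, x ∉ t) → D t = 0 := fun t ht => by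
    rw [hD, Finset.filter_eq_empty_iff.2 fun {x} hx => ht x hx]
    simp
  have hsupp : D {x | n < x.length} = 0 := hDzero _ fun x hx => not_lt.2 (hYn x hx)
  let μ := Measure.infinitePi fun _ : ℕ => D
  have hae : ∀ᵐ ω ∂μ, ∀ i, ω i ∈ Y := by
    refine ae_all_iff.2 fun i => ?_
    have hDY : ∀ᵐ x ∂D, x ∈ Y := hDzero _ fun x hx hx' => hx' hx
    exact (measurePreserving_eval_infinitePi (fun _ : ℕ => D) i).quasiMeasurePreserving.ae hDY
  let G : Finset (List (Fin q)) → Set (ℕ → List (Fin q)) := fun b =>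
    {ω | ∃ (j : ℕ) (r' : S.reps),
      OutputsAfter L (s, n, ε, δ) (firstSymbols (fun i => S.labelled (rep b) (ω i)) j) r'.1 ∧
      D (symmDiff (S.concept r') (S.concept (rep b))) ≤ ENNReal.ofReal (posRat ε)}
  have hGm : ∀ b, MeasurableSet (G b) := fun b => by
    simp only [G, Set.ofPred_exists]
    exact MeasurableSet.iUnion fun j => MeasurableSet.iUnion fun r' =>
      measurableSet_of_firstSymbols _ j fun t => OutputsAfter L (s, n, ε, δ) t r'.1 ∧
        D (symmDiff (S.concept r') (S.concept (rep b))) ≤ ENNReal.ofReal (posRat ε)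
  have hG : ∀ b, ENNReal.ofReal (1 - posRat δ) ≤ μ (G b) := fun b =>
    hL.approximates s n hs hn ε δ (rep b) (hlen b) D hsupp
  -- Average over all labellings: on almost every sequence at most half of the `2 ^ |Y|` targets are
  -- approximated, so the success probabilities sum to at most half of `2 ^ |Y|`. Yet each is at
  -- least `1 - δ > 1/2`.
  have hpoint : ∀ᵐ ω ∂μ,
      2 * ∑ b ∈ Y.powerset, (G b).indicator (1 : (ℕ → List (Fin q)) → ℝ≥0∞) ω ≤ 2 ^ Y.card := by
    filter_upwards [hae] with ω hω
    have hcount := RepSystem.two_mul_card_approximated_le (L := L) (a := (s, n, ε, δ)) hrep hlt hω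
      fun b => hL.sampleComplexity s n hs hn ε δ (rep b) (hlen b) ω fun i => hYn _ (hω i)
    have hsum : ∑ b ∈ Y.powerset, (G b).indicator (1 : (ℕ → List (Fin q)) → ℝ≥0∞) ω =
        ((Y.powerset.filter fun b => ω ∈ G b).card : ℝ≥0∞) := by
      simp [Set.indicator_apply]
    rw [hsum]
    refine le_trans ?_ (show ((_ : ℕ) : ℝ≥0∞) ≤ 2 ^ Y.card from by exact_mod_cast hcount)
    push_cast
    gcongr
    rintro ⟨j, r', hout, hDr⟩
    exact ⟨j, r', hout, hDle _ hDr⟩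
  have hint := lintegral_mono_ae hpoint
  rw [lintegral_const_mul _ (Finset.measurable_sum _ fun b _ =>
      measurable_one.indicator (hGm b)),
    lintegral_finsetSum _ fun b _ => measurable_one.indicator (hGm b)] at hint
  simp only [lintegral_indicator_one (hGm _), lintegral_const, measure_univ, mul_one] at hint
  have hsum : (2 ^ Y.card : ℝ≥0∞) * ENNReal.ofReal (1 - posRat δ) ≤
      ∑ b ∈ Y.powerset, μ (G b) := by
    have := Finset.card_nsmul_le_sum Y.powerset (fun b => μ (G b)) _ fun b _ => hG b
    simpa [Finset.card_powerset, nsmul_eq_mul] using this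
  have hfin : ENNReal.ofReal (2 * (2 ^ Y.card * (1 - posRat δ))) ≤ ENNReal.ofReal (2 ^ Y.card) := by
    rw [ENNReal.ofReal_mul (by norm_num), ENNReal.ofReal_mul (by positivity),
      ENNReal.ofReal_pow (by norm_num)]
    simpa using (mul_le_mul_right hsum 2).trans hint
  rw [ENNReal.ofReal_le_ofReal_iff (by positivity)] at hfin
  have : (0 : ℝ) < 2 ^ Y.card := by positivity
  nlinarith

/-! ### Counting strings and bits -/

section Counting

/-- Replacing `q` by `max 2 q` absorbs the maximum with one, so the bit count becomes the logarithm
of an integer. For `q = 0` the convention `log 0 = 0` is harmless. -/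
theorem exampleBits_eq_logb (q n : ℕ) : exampleBits q n = Real.logb 2 ((max 2 q : ℕ) ^ n) := by
  rw [Real.logb_pow, exampleBits]
  congr 1
  rcases le_total q 2 with h | h
  · rw [max_eq_left h, Nat.cast_two, Real.logb_self_eq_one one_lt_two]
    rcases Nat.eq_zero_or_pos q with rfl | hq
    · simp
    · refine max_eq_left ?_
      rw [Real.logb_le_iff_le_rpow one_lt_two (by exact_mod_cast hq), Real.rpow_one]
      exact_mod_cast h
  · rw [max_eq_right h]
    refine max_eq_right ?_
    rw [Real.le_logb_iff_rpow_le one_lt_two (by exact_mod_cast zero_lt_two.trans_le h),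
      Real.rpow_one]
    exact_mod_cast h

theorem one_le_exampleBits {n : ℕ} (hn : 1 ≤ n) (q : ℕ) : 1 ≤ exampleBits q n := by
  have hn' : (1 : ℝ) ≤ n := by exact_mod_cast hn
  have := le_max_left (1 : ℝ) (Real.logb 2 q)
  unfold exampleBits
  nlinarith

/-- A geometric sum of ratio at least two is dominated by twice its last term; this is why the base
is `max 2 q`. -/
theorem card_shortStrings_add_one_le (q n : ℕ) :
    (RepSystem.shortStrings q n).card + 1 ≤ 2 * (max 2 q) ^ n := by
  rw [← RepSystem.length_wordsUpTo_finRange, length_wordsUpTo, List.length_finRange]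
  have hB : 2 ≤ max 2 q := le_max_left _ _
  have hq : q ≤ max 2 q := le_max_right _ _
  generalize max 2 q = B at hB hq
  induction n with
  | zero => simp
  | succ n ih =>
    rw [Finset.sum_range_succ]
    have h1 : q ^ (n + 1) ≤ B ^ (n + 1) := Nat.pow_le_pow_left hq _
    have h2 : B ^ n * 2 ≤ B ^ (n + 1) := by rw [pow_succ]; gcongr
    omega

theorem natCast_clog_two_le {x y : ℕ} (hxy : x ≤ y) (hy : 1 ≤ y) :
    (Nat.clog 2 x : ℝ) ≤ Real.logb 2 y + 1 := by
  have h := Nat.ceil_lt_add_one (Real.logb_nonneg one_lt_two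
    (show (1 : ℝ) ≤ y from by exact_mod_cast hy))
  have hceil : ⌈Real.logb 2 y⌉₊ = Nat.clog 2 y := by
    exact_mod_cast Real.natCeil_logb_natCast 2 y
  rw [hceil] at h
  exact (Nat.cast_le.2 (Nat.clog_mono_right 2 hxy)).trans h.le

theorem Finset.exists_shatters_card_eq_vcDim {α : Type*} [DecidableEq α] {𝒜 : Finset (Finset α)}
    (h : 𝒜.vcDim ≠ 0) : ∃ Y, 𝒜.Shatters Y ∧ Y.card = 𝒜.vcDim := by
  have hne : 𝒜.shatterer.Nonempty := by
    rw [Finset.nonempty_iff_ne_empty]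
    intro he
    exact h (by simp [Finset.vcDim, he])
  obtain ⟨Y, hY, hcard⟩ := Finset.exists_mem_eq_sup _ hne Finset.card
  exact ⟨Y, Finset.mem_shatterer.1 hY, hcard.symm⟩

end Counting

/-! ### Bits needed for a representation -/

section Bits

variable {g q : ℕ} {S : RepSystem g q} {L : Learner g q} {m : ℕ → ℕ → ℝ → ℝ → ℝ}

/-- With `W = exampleBits q n`, Sauer-Shelah gives at most `2 N (1 + W)` bits plus one for rounding.
The factor `3` comes from `1 + W ≤ 3/2 W`, which needs `W ≥ 2`; the finitely many smaller cases are
absorbed by the additive `6`. -/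
theorem clog_canonicalReps_le {s n : ℕ} (hn : 1 ≤ n) {N : ℝ} (hN : 0 ≤ N)
    (hd : ((S.traces s n).vcDim : ℝ) ≤ 2 * N) :
    (Nat.clog 2 (S.canonicalReps s n).length : ℝ) ≤ 3 * exampleBits q n * N + 6 := by
  have hT := card_shortStrings_add_one_le q n
  have hW := one_le_exampleBits hn q
  have hlog := exampleBits_eq_logb q n
  have hB : 0 < (max 2 q) ^ n := pow_pos (zero_lt_two.trans_le (le_max_left _ _)) _
  rcases lt_or_ge ((max 2 q) ^ n) 4 with hsmall | hlarge
  -- Here `|Σ^{≤ n}| + 1 ≤ 2 * 3`, so the trivial bound by the number of subsets suffices.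
  · have hle : (S.canonicalReps s n).length ≤ 2 ^ 6 :=
      (RepSystem.length_canonicalReps_le_two_pow s n).trans
        (Nat.pow_le_pow_right two_pos (by omega))
    have : (Nat.clog 2 (S.canonicalReps s n).length : ℝ) ≤ 6 := by
      exact_mod_cast Nat.clog_le_of_le_pow hle
    have : 0 ≤ 3 * exampleBits q n * N := by positivity
    linarith
  · have hW2 : 2 ≤ exampleBits q n := by
      rw [hlog, Real.le_logb_iff_rpow_le one_lt_two (by exact_mod_cast hB)]
      norm_num
      exact_mod_cast hlarge
    have hclog := natCast_clog_two_le
      (RepSystem.length_canonicalReps_le_pow_vcDim (S := S) s n) (Nat.one_le_pow _ _ (by omega))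
    rw [Nat.cast_pow, Real.logb_pow] at hclog
    have hTlog : Real.logb 2 ((RepSystem.shortStrings q n).card + 1 : ℕ) ≤
        1 + exampleBits q n := by
      have h1 : Real.logb 2 ((RepSystem.shortStrings q n).card + 1 : ℕ) ≤
          Real.logb 2 (2 * (max 2 q : ℕ) ^ n) :=
        Real.logb_le_logb_of_le one_lt_two (by positivity) (by exact_mod_cast hT)
      rwa [Real.logb_mul two_ne_zero (by exact_mod_cast hB.ne'),
        Real.logb_self_eq_one one_lt_two, ← hlog] at h1
    have h2 : ((S.traces s n).vcDim : ℝ) *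
        Real.logb 2 ((RepSystem.shortStrings q n).card + 1 : ℕ) ≤
          2 * N * (3 / 2 * exampleBits q n) :=
      mul_le_mul hd (by linarith) (Real.logb_nonneg one_lt_two (by simp)) (by linarith)
    linarith

/-- Three labelled examples cost `3 (2 + W)` bits, where `W = exampleBits q n`, plus one for
rounding; `N ≥ 1` hides `3 W` inside `3 W N`. -/
theorem clog_smallSampleReps_le {s n : ℕ} (hn : 1 ≤ n) {N : ℝ} (hN : 1 ≤ N) :
    (Nat.clog 2 (S.smallSampleReps 3 s n).length : ℝ) ≤ 3 * exampleBits q n * N + 7 := by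
  have hT := card_shortStrings_add_one_le q n
  have hW := one_le_exampleBits hn q
  have hB : 0 < (max 2 q) ^ n := pow_pos (zero_lt_two.trans_le (le_max_left _ _)) _
  have hle : (S.smallSampleReps 3 s n).length ≤ (4 * (max 2 q) ^ n) ^ 3 :=
    (RepSystem.length_smallSampleReps_le 3 s n).trans (Nat.pow_le_pow_left (by omega) 3)
  have hclog := natCast_clog_two_le hle (Nat.one_le_pow _ _ (by omega))
  have h4 : Real.logb 2 4 = 2 := by
    rw [show (4 : ℝ) = 2 ^ (2 : ℕ) by norm_num, Real.logb_pow, Real.logb_self_eq_one one_lt_two]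
    norm_num
  push_cast at hclog
  have hB' : ((max 2 q : ℕ) : ℝ) ^ n ≠ 0 := by exact_mod_cast hB.ne'
  push_cast at hB'
  have hlog := exampleBits_eq_logb q n
  push_cast at hlog
  rw [Real.logb_pow, Real.logb_mul (by norm_num) hB', h4, ← hlog] at hclog
  push_cast at hclog
  nlinarith

/-- At accuracy `1/4` a shattered set of size `d` yields `d ≤ m + 2 (d / 4)`. -/
theorem IsDeterministicPac.vcDim_le (hL : IsDeterministicPac S L m) {s n : ℕ} (hs : 1 ≤ s)
    (hn : 1 ≤ n) (δ : ℕ × ℕ) (hδ : posRat δ < 1 / 2) (hm : 0 ≤ m n s (1 / 4) (posRat δ)) :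
    ((S.traces s n).vcDim : ℝ) ≤ 2 * m n s (1 / 4) (posRat δ) := by
  by_cases h0 : (S.traces s n).vcDim = 0
  · rw [h0]; simpa using hm
  obtain ⟨Y, hY, hcard⟩ := Finset.exists_shatters_card_eq_vcDim h0
  have hε : posRat (0, 3) = 1 / 4 := by norm_num [posRat]
  have h := hL.card_le_of_shatters hs hn (0, 3) δ hδ (Finset.card_pos.1 (by omega)) hY
  rw [hε, hcard] at h
  have := Nat.floor_le (show (0 : ℝ) ≤ 1 / 4 * (S.traces s n).vcDim by positivity)
  linarith

/-- On a point mass, accuracy `1/2` tolerates no error, so a learner must look at the one shattered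
point. This is the coarsest accuracy that occurs, belonging to samples of one example. -/
theorem IsDeterministicPac.one_le_of_vcDim_ne_zero (hL : IsDeterministicPac S L m) {s n : ℕ}
    (hs : 1 ≤ s) (hn : 1 ≤ n) (δ : ℕ × ℕ) (hδ : posRat δ < 1 / 2)
    (h0 : (S.traces s n).vcDim ≠ 0) : 1 ≤ m n s (1 / 2) (posRat δ) := by
  obtain ⟨Y, hY, hcard⟩ := Finset.exists_shatters_card_eq_vcDim h0
  obtain ⟨x, hx⟩ := Finset.card_pos.1 (hcard ▸ Nat.pos_of_ne_zero h0)
  have hε : posRat (0, 1) = 1 / 2 := by norm_num [posRat]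
  have h := hL.card_le_of_shatters hs hn (0, 1) δ hδ (Finset.singleton_nonempty x)
    (hY.mono_right (Finset.singleton_subset_iff.2 hx))
  have hfloor : ⌊(1 / 2 : ℝ)⌋₊ = 0 := Nat.floor_eq_zero.2 (by norm_num)
  rw [hε, Finset.card_singleton, Nat.cast_one, mul_one, hfloor] at h
  simpa using h

end Bits

/-! ### The Occam algorithm -/

namespace RepSystem

variable {g q : ℕ} {S : RepSystem g q}

variable (S) in
/-- The algorithm that finds the first consistent representation of length at most `s`.  It does
not toss coins. -/
noncomputable def consistentSearch : SampleCompressor g q :=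
  fun z => Part.ofOption ((S.firstConsistent z.1.1 z.1.2.2.2).map some)

theorem Effective.partrec_consistentSearch (hS : S.Effective) : Partrec S.consistentSearch :=
  Computable.ofOption (Computable.option_map
    (hS.computable_firstConsistent.comp (Computable.fst.comp Computable.fst)
      (Computable.snd.comp (Computable.snd.comp (Computable.snd.comp Computable.fst))))
    (Computable.option_some.comp Computable.snd))

/-- The output of `consistentSearch` has small complexity when a pac-algorithm exists.

The pac-algorithm bounds the Vapnik-Chervonenkis dimension `d` of the concepts of `R^{≤ s}` on
`Σ^{≤ n}` by its sample complexity, and by the Sauer-Shelah lemma `d` bounds the number of possible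
outputs, each of which is determined by its index among the canonical representations.  Samples of
at most three examples, for which the accuracy is too coarse to bound `d`, determine the output
directly.  No majorities have to be formed. -/
theorem Effective.exists_prefixK_firstConsistent_le (hS : S.Effective) {L : Learner g q}
    {m : ℕ → ℕ → ℝ → ℝ → ℝ} (hL : IsDeterministicPac S L m)
    (hpos : ∀ n s : ℕ, 1 ≤ n → 1 ≤ s → ∀ ε δ : ℝ, 0 < ε → 0 < δ → 0 < m n s ε δ)
    (hanti : ∀ n s : ℕ, 1 ≤ n → 1 ≤ s → ∀ δ : ℝ, 0 < δ →
      AntitoneOn (fun ε : ℝ => m n s ε δ) (Set.Ioi 0)) :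
    ∃ C : ℝ, ∀ s n : ℕ, 1 ≤ s → 1 ≤ n → ∀ δ : ℕ × ℕ, posRat δ < 1 / 2 → ∀ r : S.reps,
      ∀ xs : List (List (Fin q)), xs ≠ [] → (∀ x ∈ xs, x.length ≤ n) → ∀ r' : List (Fin g),
        S.firstConsistent s (xs.map (S.labelled r)) = some r' →
        (prefixK r' (r.1, n, s) : ℝ) <
          3 * exampleBits q n * m n s (1 / (2 * √(xs.length : ℝ))) (posRat δ) + C := by
  have hn' : Computable fun y : List (Fin g) × ℕ × ℕ => y.2.1 :=
    Computable.fst.comp Computable.snd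
  have hs' : Computable fun y : List (Fin g) × ℕ × ℕ => y.2.2 :=
    Computable.snd.comp Computable.snd
  obtain ⟨C₁, hC₁⟩ := exists_prefixK_le_clog (hS.computable_canonicalReps.comp hs' hn')
  obtain ⟨C₂, hC₂⟩ := exists_prefixK_le_clog ((hS.computable_smallSampleReps 3).comp hs' hn')
  -- The two cases leave `6` and `7` bits over; one more makes the inequality strict.
  refine ⟨C₁ + C₂ + 8, fun s n hs hn δ hδ r xs hxs hlen r' h => ?_⟩
  have hδ0 : 0 < posRat δ := by unfold posRat; positivity
  have hW := one_le_exampleBits hn q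
  have hk : 1 ≤ xs.length := List.length_pos_iff.2 hxs
  have hk' : (1 : ℝ) ≤ xs.length := by exact_mod_cast hk
  have hsqrt : 1 ≤ √(xs.length : ℝ) := Real.one_le_sqrt.2 hk'
  have hεpos : 0 < 1 / (2 * √(xs.length : ℝ)) := by positivity
  have hN0 := hpos n s hn hs _ _ hεpos hδ0
  have hmono : ∀ c : ℝ, 0 < c → c ≤ √(xs.length : ℝ) →
      m n s (1 / (2 * c)) (posRat δ) ≤ m n s (1 / (2 * √(xs.length : ℝ))) (posRat δ) := by
    intro c hc hle
    exact hanti n s hn hs _ hδ0 hεpos (show (0 : ℝ) < 1 / (2 * c) by positivity) (by gcongr)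
  have hpre₁ := hC₁ (r.1, n, s) r' (firstConsistent_mem_canonicalReps hlen h)
  have hpre₁' : (prefixK r' (r.1, n, s) : ℝ) ≤
      Nat.clog 2 (S.canonicalReps s n).length + C₁ := by exact_mod_cast hpre₁
  have hC₁0 : (0 : ℝ) ≤ C₁ := C₁.cast_nonneg
  have hC₂0 : (0 : ℝ) ≤ C₂ := C₂.cast_nonneg
  have hprod : 0 ≤ 3 * exampleBits q n * m n s (1 / (2 * √(xs.length : ℝ))) (posRat δ) := by
    positivity
  rcases le_or_gt 4 xs.length with h4 | h3
  · have hm := hmono 2 two_pos (Real.le_sqrt_of_sq_le (by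
      have : (4 : ℝ) ≤ xs.length := by exact_mod_cast h4
      linarith))
    norm_num only at hm
    have hd := hL.vcDim_le hs hn δ hδ (hpos n s hn hs _ _ (by norm_num) hδ0).le
    have := clog_canonicalReps_le hn hN0.le (hd.trans (by linarith))
    linarith
  -- In dimension zero there is at most one canonical representation, which needs no index bits, and
  -- no lower bound on the sample complexity is required.
  · by_cases h0 : (S.traces s n).vcDim = 0
    · have hle := length_canonicalReps_le_pow_vcDim (S := S) s n
      rw [h0, pow_zero] at hle
      rw [Nat.clog_of_right_le_one hle, Nat.cast_zero] at hpre₁'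
      linarith
    · have hm := hmono 1 one_pos hsqrt
      rw [mul_one] at hm
      have h1 := hL.one_le_of_vcDim_ne_zero hs hn δ hδ h0
      have hpre₂ := hC₂ (r.1, n, s) r'
        (firstConsistent_mem_smallSampleReps (Nat.lt_succ_iff.1 h3) hlen h)
      have hpre₂' : (prefixK r' (r.1, n, s) : ℝ) ≤
          Nat.clog 2 (S.smallSampleReps 3 s n).length + C₂ := by exact_mod_cast hpre₂
      have := clog_smallSampleReps_le (S := S) (s := s) hn (h1.trans hm)
      linarith

end RepSystem

/-! ### Growth of the compression -/

section Growth

variable {q n s : ℕ} {m : ℕ → ℕ → ℝ → ℝ → ℝ} {γ : ℝ}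

theorem one_div_sq_one_div_two_mul_sqrt (k : ℕ) : 1 / (1 / (2 * √(k : ℝ))) ^ 2 = 4 * k := by
  rw [one_div_pow, one_div_one_div, mul_pow, Real.sq_sqrt k.cast_nonneg]
  norm_num

/-- With `ε = 1 / (2 √k)` the compression is a constant times the reciprocal of `ε² m(n, s, ε,
γ/3)`, a positive quantity that tends to zero. -/
theorem tendsto_majCompression (hn : 1 ≤ n)
    (hpos : ∀ ε : ℝ, 0 < ε → 0 < m n s ε (γ / 3))
    (hlittle : Asymptotics.IsLittleO (𝓝[>] (0 : ℝ)) (fun ε : ℝ => m n s ε (γ / 3))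
      (fun ε : ℝ => 1 / ε ^ 2)) :
    Tendsto (fun k : ℕ => majCompression q m k n s γ) atTop atTop := by
  have hW := one_le_exampleBits hn q
  have hε : Tendsto (fun k : ℕ => 1 / (2 * √(k : ℝ))) atTop (𝓝[>] (0 : ℝ)) := by
    simp only [one_div]
    exact tendsto_inv_atTop_nhdsGT_zero.comp
      ((Real.tendsto_sqrt_atTop.comp tendsto_natCast_atTop_atTop).const_mul_atTop two_pos)
  have hquot : Tendsto (fun k : ℕ => m n s (1 / (2 * √(k : ℝ))) (γ / 3) / (4 * k)) atTop
      (𝓝[>] (0 : ℝ)) := by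
    refine tendsto_nhdsWithin_iff.2 ⟨?_, ?_⟩
    · refine (hlittle.tendsto_div_nhds_zero.comp hε).congr fun k => ?_
      simp only [Function.comp_apply, one_div_sq_one_div_two_mul_sqrt]
    · filter_upwards [eventually_gt_atTop 0] with k hk
      have hk' : (0 : ℝ) < k := by exact_mod_cast hk
      exact div_pos (hpos _ (by positivity)) (by positivity)
  refine (hquot.inv_tendsto_nhdsGT_zero.const_mul_atTop
    (show 0 < 1 / (12 * exampleBits q n) by positivity)).congr fun k => ?_
  simp only [majCompression, Pi.inv_apply, inv_div]
  rw [div_mul_div_comm, one_mul, show 12 * exampleBits q n * m n s (1 / (2 * √(k : ℝ))) (γ / 3) =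
    4 * (3 * exampleBits q n * m n s (1 / (2 * √(k : ℝ))) (γ / 3)) by ring]
  exact mul_div_mul_left _ _ four_ne_zero

/-- The same identity, now using that `ε = 1 / (2 √k)` decreases in `k`. -/
theorem majCompression_mono (hn : 1 ≤ n)
    (hpos : ∀ ε : ℝ, 0 < ε → 0 < m n s ε (γ / 3))
    (hmono : MonotoneOn (fun ε : ℝ => ε ^ 2 * m n s ε (γ / 3)) (Set.Ioi 0)) {k k' : ℕ}
    (hk : 1 ≤ k) (hkk' : k ≤ k') :
    majCompression q m k n s γ ≤ majCompression q m k' n s γ := by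
  have hW := one_le_exampleBits hn q
  have hk0 : (0 : ℝ) < k := by exact_mod_cast hk
  have hk0' : (0 : ℝ) < k' := by exact_mod_cast hk.trans hkk'
  have hle : (k : ℝ) ≤ k' := by exact_mod_cast hkk'
  have h := hmono (show (0 : ℝ) < 1 / (2 * √(k' : ℝ)) by positivity)
    (show (0 : ℝ) < 1 / (2 * √(k : ℝ)) by positivity)
    (by gcongr)
  have hsq : ∀ i : ℕ, (1 / (2 * √(i : ℝ))) ^ 2 = 1 / (4 * i) := fun i => by
    rw [← one_div_sq_one_div_two_mul_sqrt, one_div_one_div]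
  simp only [hsq] at h
  have hm := hpos (1 / (2 * √(k : ℝ))) (by positivity)
  have hm' := hpos (1 / (2 * √(k' : ℝ))) (by positivity)
  rw [one_div_mul_eq_div, one_div_mul_eq_div, div_le_div_iff₀ (by positivity) (by positivity)] at h
  unfold majCompression
  rw [div_le_div_iff₀ (by positivity) (by positivity)]
  nlinarith

end Growth

/-! ### The Occam theorem -/

theorem theorem3 {g q : ℕ} (S : RepSystem g q) (hS : S.Effective)
    (L : Learner g q) (m : ℕ → ℕ → ℝ → ℝ → ℝ) (hL : IsDeterministicPac S L m)
    (hpos : ∀ n s : ℕ, 1 ≤ n → 1 ≤ s → ∀ ε δ : ℝ, 0 < ε → 0 < δ → 0 < m n s ε δ)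
    (hanti : ∀ n s : ℕ, 1 ≤ n → 1 ≤ s → ∀ δ : ℝ, 0 < δ →
      AntitoneOn (fun ε : ℝ => m n s ε δ) (Set.Ioi 0))
    (hlittle : ∀ n s : ℕ, 1 ≤ n → 1 ≤ s → ∀ δ : ℝ, 0 < δ →
      Asymptotics.IsLittleO (𝓝[>] (0 : ℝ)) (fun ε : ℝ => m n s ε δ) (fun ε : ℝ => 1 / ε ^ 2))
    (M : List (Fin g) × List (Fin g) × List (Fin g) →. List (Fin g)) (e : ℕ → ℕ)
    (hM : IsMajorityOfThree S M e) :
    (∃ A : SampleCompressor g q, IsOccam S A (majCompression q m)) ∧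
    (∀ n s : ℕ, 1 ≤ n → 1 ≤ s → ∀ γ : ℝ, 0 < γ →
      MonotoneOn (fun ε : ℝ => ε ^ 2 * m n s ε (γ / 3)) (Set.Ioi 0) →
      ∀ k k' : ℕ, 1 ≤ k → k ≤ k' →
        majCompression q m k n s γ ≤ majCompression q m k' n s γ) := by
  have hthird : ∀ γ : ℕ × ℕ, posRat (γ.1, 3 * γ.2 + 2) = posRat γ / 3 := fun γ => by
    unfold posRat
    push_cast
    field_simp
    ring
  refine ⟨⟨S.consistentSearch, hS.partrec_consistentSearch, ?_, ?_⟩, ?_⟩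
  · obtain ⟨C, hC⟩ := hS.exists_prefixK_firstConsistent_le hL hpos hanti
    refine ⟨C, fun s n hs hn γ r hr xs hxs hlen => ?_⟩
    have hγ : 0 < posRat γ := by unfold posRat; positivity
    -- For `γ ≥ 1` nothing is claimed. For `γ < 1` the confidence `γ / 3` is below `1/2`, as the
    -- averaging argument requires.
    rcases le_or_gt 1 (posRat γ) with hγ1 | hγ1
    · rw [ENNReal.ofReal_of_nonpos (by linarith)]
      exact zero_le
    obtain ⟨r', hr', hcons⟩ := RepSystem.exists_firstConsistent hr xs
    have hK := hC s n hs hn (γ.1, 3 * γ.2 + 2) (by rw [hthird]; linarith) r xs hxs hlen _ hr'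
    rw [hthird] at hK
    have hk0 : (0 : ℝ) < xs.length := by exact_mod_cast List.length_pos_iff.2 hxs
    have hdiv : (xs.length : ℝ) / majCompression q m xs.length n s (posRat γ) =
        3 * exampleBits q n * m n s (1 / (2 * √(xs.length : ℝ))) (posRat γ / 3) := by
      rw [majCompression, div_div_cancel₀ hk0.ne']
    rw [← hdiv] at hK
    have hout : OutputsAfter S.consistentSearch (s, n, γ, xs.map (S.labelled r)) [] r'.1 :=
      ⟨by simp [RepSystem.consistentSearch, hr'],
        fun u hu hne => absurd (List.prefix_nil.1 hu) hne⟩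
    have : IsProbabilityMeasure coinTosses := by unfold coinTosses; infer_instance
    refine (ENNReal.ofReal_le_one.2 (by linarith)).trans ?_
    rw [← measure_univ (μ := coinTosses)]
    -- The search stops before any coin is tossed, so the event is the whole space.
    exact measure_mono fun ω _ => ⟨0, r', hout, hcons, hK⟩
  · exact fun n s hn hs γ hγ => tendsto_majCompression hn
      (fun ε hε => hpos n s hn hs ε _ hε (by positivity)) (hlittle n s hn hs _ (by positivity))
  · exact fun n s hn hs γ hγ hmono k k' hk hkk' => majCompression_mono hn
      (fun ε hε => hpos n s hn hs ε _ hε (by positivity)) hmono hk hkk'
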